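/- Let $\Gamma$ be a finite set with at least two elements and let $\mathcal D_\Gamma$ be the Dyck (polycyclic) inverse monoid: the monoid with zero generated by $\gamma(-),\gamma(+)$, $\gamma\in\Gamma$, with the relations $\gamma(-)\gamma(+)=1$ and $\gamma(-)\gamma'(+)=0$ for $\gamma\neq\gamma'$. Let $G_\circ$ be an irreducible finite directed graph (loops and multiple edges allowed; the graph with one vertex and no edges is also allowed) with a distinguished vertex $v_\circ$ and a labeling $\lambda_\circ$ of its edges by a finite alphabet $\Sigma_\circ$ that is 1-right resolving, i.e. every vertex has, for each label, at most one outgoing edge with that label. Let $K_\gamma^-,K_\gamma^+$ ($\gamma\in\Gamma$) be positive integers. Let $G=G(\lambda_\circ,v_\circ,(K_\gamma^-,K_\gamma^+)_{\gamma\in\Gamma})$ be the labeled graph obtained from $G_\circ$ by attaching to $v_\circ$ loops $e(\gamma(-),k)$, $1\le k\le K_\gamma^-$, and $e(\gamma(+),k)$, $1\le k\le K_\gamma^+$, $\gamma\in\Gamma$, labeled by themselves. Set $\varphi(\sigma)=1$ for $\sigma\in\Sigma_\circ$, $\varphi(e(\gamma(-),k))=\gamma(-)$ and $\varphi(e(\gamma(+),k))=\gamma(+)$.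 A path in $G$ (with arbitrary initial and final vertex) is admissible if the product in $\mathcal D_\Gamma$ of the images under $\varphi$ of its labels is not $0$. Let $X(G)$ be the subshift whose admissible words are the label sequences of the admissible paths in $G$; that is, $X(G)$ consists of the bi-infinite sequences all of whose finite subwords are such label sequences. Set $K_-=\sum_{\gamma\in\Gamma}K_\gamma^-$, $K_+=\sum_{\gamma\in\Gamma}K_\gamma^+$, $K=\sum_{\gamma\in\Gamma}K_\gamma^-K_\gamma^+$. Let $\mathcal R$ be the set of paths in $G_\circ$ that start and end at $v_\circ$, including the path of length $0$, and let $g(\mathcal R,z)=\sum_{n\ge 0}r_nz^n$, where $r_n$ is the number of paths of length $n$ in $\mathcal R$. **Corollary 2.4.** Assume $K_-\ge K_+$. Then there is a smallest positive real number $z_0$ at which the series $g(\mathcal R,z)$ converges and $$z\,g(\mathcal R,z)=\frac{K_-}{K_-^2+K}$$ holds, and the topological entropy of $X(G)$ is $$h(X(G))=\lim_{n\to\infty}\frac1n\log\operatorname{card}\mathcal L_n(X(G))=-\log z_0,$$ where $\mathcal L_n(X(G))$ is the set of words of length $n$ that appear in points of $X(G)$ (the existence of the limit being part of the claim). -/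

import Mathlib

open Filter Topology

namespace DyckSofic

/-! ### Words, generating functions, entropy -/

/-- The number of words of length `n` in a formal language. -/
noncomputable def wordCount {A : Type*} (L : Set (List A)) (n : ℕ) : ℕ :=
  {w : List A | w ∈ L ∧ w.length = n}.ncard

/-- The generating function `g(L, z) = ∑ₙ card {w ∈ L : |w| = n} zⁿ` of the formal language `L`
converges at `z`, with value `s`. -/
def HasGenValue {A : Type*} (L : Set (List A)) (z s : ℝ) : Prop :=
  HasSum (fun n : ℕ => (wordCount L n : ℝ) * z ^ n) s

/-- The word of length `n` that appears in the point `x` at the position `i`. -/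
def blockAt {A : Type*} (x : ℤ → A) (i : ℤ) (n : ℕ) : List A :=
  List.ofFn fun k : Fin n => x (i + (k : ℤ))

open SymbolicDynamics.FullShift in
/-- The language of a subshift: the words that appear somewhere in one of its points. -/
def language {A : Type*} [TopologicalSpace A] (X : Subshift A ℤ) : Set (List A) :=
  {w | ∃ x ∈ X.carrier, ∃ i : ℤ, ∃ n : ℕ, w = blockAt x i n}

open SymbolicDynamics.FullShift in
/-- The topological entropy `lim (1/n) log card Lₙ(X)` of the subshift `X` exists and is `h`. -/
def HasTopologicalEntropy {A : Type*} [TopologicalSpace A] (X : Subshift A ℤ) (h : ℝ) : Prop :=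
  Tendsto (fun n : ℕ => 1 / (n : ℝ) * Real.log (wordCount (language X) n)) atTop (𝓝 h)

open SymbolicDynamics.FullShift in
/-- The subshift of all points all of whose words belong to `L`. If `L` is closed under passing to
subwords and each of its words extends to a longer word of `L` on both sides, this is the unique
subshift with admissible words `L`. -/
def subshiftOfWords {A : Type*} [TopologicalSpace A] [DiscreteTopology A] (L : Set (List A)) :
    Subshift A ℤ where
  carrier := {x | ∀ (i : ℤ) (n : ℕ), blockAt x i n ∈ L}
  isClosed := by
    have h : {x : ℤ → A | ∀ (i : ℤ) (n : ℕ), blockAt x i n ∈ L} =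
        ⋂ (i : ℤ) (n : ℕ), (fun (x : ℤ → A) (k : Fin n) => x (i + (k : ℤ))) ⁻¹'
          {u : Fin n → A | List.ofFn u ∈ L} := by
      ext x; simp [blockAt]
    rw [h]
    refine isClosed_iInter fun i => isClosed_iInter fun n => ?_
    exact (isClosed_discrete _).preimage (by fun_prop)
  mapsTo := by
    intro g x hx i n
    have := hx (g + i) n
    simpa [blockAt, add_assoc] using this

/-! ### The Dyck inverse monoid -/

/-- Generators `γ(-)`, `γ(+)`, together with a symbol for the zero element. -/
inductive DyckGen (Γ : Type*) where
  | neg (γ : Γ)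
  | pos (γ : Γ)
  | zero

/-- The defining relations of the Dyck inverse monoid, as a monoid with zero. -/
inductive DyckRel {Γ : Type*} : FreeMonoid (DyckGen Γ) → FreeMonoid (DyckGen Γ) → Prop where
  | cancel (γ : Γ) : DyckRel (.of (.neg γ) * .of (.pos γ)) 1
  | vanish (γ γ' : Γ) (h : γ ≠ γ') : DyckRel (.of (.neg γ) * .of (.pos γ')) (.of .zero)
  | zero_mul (a : DyckGen Γ) : DyckRel (.of .zero * .of a) (.of .zero)
  | mul_zero (a : DyckGen Γ) : DyckRel (.of a * .of .zero) (.of .zero)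

/-- The Dyck inverse monoid (polycyclic inverse monoid) with generators indexed by `Γ`. -/
abbrev DyckMonoid (Γ : Type*) := PresentedMonoid (DyckRel (Γ := Γ))

/-- The generator `γ(-)`. -/
def DyckMonoid.neg {Γ : Type*} (γ : Γ) : DyckMonoid Γ := PresentedMonoid.of DyckRel (.neg γ)

/-- The generator `γ(+)`. -/
def DyckMonoid.pos {Γ : Type*} (γ : Γ) : DyckMonoid Γ := PresentedMonoid.of DyckRel (.pos γ)

/-- The zero element. -/
def DyckMonoid.zero (Γ : Type*) : DyckMonoid Γ := PresentedMonoid.of DyckRel .zero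

/-! ### Labeled directed graphs -/

/-- A directed graph (loops and multiple edges are allowed) with vertices `V` and edges `E`,
whose edges carry labels in `S`. -/
structure LabeledGraph (V E S : Type*) where
  src : E → V
  tgt : E → V
  label : E → S

/-- `p` is the edge sequence of a path from the first to the second vertex; at each vertex there is
a path of length zero. -/
def LabeledGraph.IsPath {V E S : Type*} (G : LabeledGraph V E S) : V → List E → V → Prop
  | v, [], w => v = w
  | v, e :: p, w => G.src e = v ∧ G.IsPath (G.tgt e) p w

/-- Every vertex can be reached from every vertex. The graph with one vertex and no edges counts as
irreducible. -/
def LabeledGraph.Irreducible {V E S : Type*} (G : LabeledGraph V E S) : Prop :=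
  ∀ v w : V, ∃ p : List E, G.IsPath v p w

/-- The labeling is 1-right resolving: for every label, every vertex has at most one outgoing edge
that carries this label. -/
def LabeledGraph.RightResolving {V E S : Type*} (G : LabeledGraph V E S) : Prop :=
  ∀ e e' : E, G.src e = G.src e' → G.label e = G.label e' → e = e'

/-- The set of paths that start and end at `v`, the path of length zero included. -/
def LabeledGraph.closedPaths {V E S : Type*} (G : LabeledGraph V E S) (v : V) : Set (List E) :=
  {p | G.IsPath v p v}

/-! ### Attaching loops -/

/-- The disjoint union of `B` and of the symbols `e(γ(-), k)`, with `Km γ` many `k`, and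
`e(γ(+), k)`, with `Kp γ` many `k`. It is used with `B` the set of edges and with `B` the set of
labels of a labeled graph. -/
inductive Attached {Γ : Type*} (B : Type*) (Km Kp : Γ → ℕ) where
  | base (b : B)
  | neg (γ : Γ) (k : Fin (Km γ))
  | pos (γ : Γ) (k : Fin (Kp γ))

instance {Γ : Type*} (B : Type*) (Km Kp : Γ → ℕ) : TopologicalSpace (Attached B Km Kp) := ⊥

instance {Γ : Type*} (B : Type*) (Km Kp : Γ → ℕ) : DiscreteTopology (Attached B Km Kp) := ⟨rfl⟩

/-- The graph obtained from `G` by attaching the loops `e(γ(-), k)` and `e(γ(+), k)`, labeled by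
themselves, to the vertex `v₀`. -/
def LabeledGraph.attach {V E S Γ : Type*} (G : LabeledGraph V E S) (v₀ : V) (Km Kp : Γ → ℕ) :
    LabeledGraph V (Attached E Km Kp) (Attached S Km Kp) where
  src
    | .base e => G.src e
    | .neg _ _ => v₀
    | .pos _ _ => v₀
  tgt
    | .base e => G.tgt e
    | .neg _ _ => v₀
    | .pos _ _ => v₀
  label
    | .base e => .base (G.label e)
    | .neg γ k => .neg γ k
    | .pos γ k => .pos γ k

/-- The map `φ` from symbols to `{γ(-), γ(+) : γ ∈ Γ} ∪ {1}`. -/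
def phi {S Γ : Type*} {Km Kp : Γ → ℕ} : Attached S Km Kp → DyckMonoid Γ
  | .base _ => 1
  | .neg γ _ => DyckMonoid.neg γ
  | .pos γ _ => DyckMonoid.pos γ

/-- The label sequences of the admissible paths in the graph with attached loops. A path is
admissible if applying `φ` to its labels gives an admissible word of the Motzkin shift, which means
that the product in the Dyck inverse monoid is not zero. -/
def admissibleWords {V E S Γ : Type*} (G : LabeledGraph V E S) (v₀ : V) (Km Kp : Γ → ℕ) :
    Set (List (Attached S Km Kp)) :=
  {w | ∃ (p : List (Attached E Km Kp)) (u v : V), (G.attach v₀ Km Kp).IsPath u p v ∧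
    w = p.map (G.attach v₀ Km Kp).label ∧ (w.map phi).prod ≠ DyckMonoid.zero Γ}

/-- The subshift constructed from `G`, `v₀` and the multiplicities `Km`, `Kp`. -/
def attachedSubshift {V E S Γ : Type*} (G : LabeledGraph V E S) (v₀ : V) (Km Kp : Γ → ℕ) :
    SymbolicDynamics.FullShift.Subshift (Attached S Km Kp) ℤ :=
  subshiftOfWords (admissibleWords G v₀ Km Kp)

end DyckSofic

open Filter Topology

namespace DyckSofic

open scoped ENNReal

/-! ### Submultiplicative sequences and power series -/

/-! Call a closed path at `v₀` balanced if its product is `1`, and let `M(z)` be the generating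
function of the balanced paths. Splitting off the last matched pair of loops gives an unambiguous
grammar, hence `M = g + K z² M² g`. An admissible closed path at `v₀` is a sequence of balanced
paths separated by its unmatched loops, all closing ones before all opening ones. So its generating
function is at most `M / ((1 - K₋ z M)(1 - K₊ z M))`, and by irreducibility this controls all
admissible words. Conversely, paths without unmatched closing loops are determined by their labels,
since the labeling is right resolving, and they occur in points of the subshift; they contribute `M
/ (1 - K₋ z M)`.

The critical point is therefore `K₋ z M(z) = 1`. Substituting `M = 1 / (K₋ z)` into the quadratic
equation gives exactly `z g(z) = K₋ / (K₋² + K)`. At such a `z₀` the number `t = K₋ z₀ M(z₀)` is `1`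
or `K₋² / K`; both are at least `1` because `K₊ ≤ K₋` forces `K ≤ K₋²`. For `z < z₀` the constant `1
/ (K₋ z₀)` is a supersolution, so `K₋ z M(z) ≤ z / z₀ < 1`, and `K₊ z M(z) < 1` as well. Thus the
word series of the subshift converges below `z₀` and diverges at `z₀` (`genFun_language_ne_top`,
`genFun_language_eq_top`), and Fekete's lemma turns this into the entropy `-log z₀`.

A solution `z₀` exists because the convergence set of `g` is open to the right
(`exists_summable_of_irreducible`), so that `z g(z)` takes every positive value; it is unique by
strict monotonicity. -/

theorem summable_of_submultiplicative {u : ℕ → ℝ} (h0 : ∀ n, 0 ≤ u n)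
    (hmul : ∀ m n, u (m + n) ≤ u m * u n) {N : ℕ} (hN : 0 < N) (h1 : u N < 1) : Summable u := by
  have : NeZero N := ⟨hN.ne'⟩
  -- Division with remainder, `n = k N + r`, bounds `u n` by `u N ^ k * u r`: a geometric series
  -- times finitely many factors.
  rw [← (Nat.divModEquiv N).symm.summable_iff]
  have hs : Summable fun x : ℕ × Fin N => u N ^ x.1 * u x.2 :=
    (summable_geometric_of_lt_one (h0 N) h1).mul_of_nonneg (g := fun r : Fin N => u r)
      (Summable.of_finite) (fun _ => pow_nonneg (h0 N) _) (fun _ => h0 _)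
  refine Summable.of_nonneg_of_le (fun _ => h0 _) ?_ hs
  rintro ⟨k, r⟩
  have key : u (k * N + r) ≤ u N ^ k * u r := by
    induction k with
    | zero => simp
    | succ k ih =>
      calc u ((k + 1) * N + r) = u (N + (k * N + r)) := by congr 1; ring
        _ ≤ u N * u (k * N + r) := hmul _ _
        _ ≤ u N * (u N ^ k * u r) := by gcongr; exact h0 N
        _ = u N ^ (k + 1) * u r := by ring
  simpa [Nat.divModEquiv, add_comm, mul_comm] using key

/-- If a power series with nonnegative coefficients and positive constant term converges in an
open interval, then its product with the variable takes all positive values. -/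
theorem exists_mul_tsum_eq {r : ℕ → ℝ} (h0 : ∀ n, 0 ≤ r n) (h1 : 1 ≤ r 0)
    (hopen : ∀ z, 0 ≤ z → Summable (fun n => r n * z ^ n) →
      ∃ z₁, z < z₁ ∧ Summable (fun n => r n * z₁ ^ n)) {c : ℝ} (hc : 0 < c) :
    ∃ z, 0 < z ∧ Summable (fun n => r n * z ^ n) ∧ z * ∑' n, r n * z ^ n = c := by
  -- Bounding the partial sums, and not the `tsum` (which is `0` when the series diverges), makes
  -- `S` closed and forces convergence on it. Its maximum is the solution.
  let S : Set ℝ := {z | 0 ≤ z ∧ ∀ N, z * ∑ n ∈ Finset.range N, r n * z ^ n ≤ c}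
  have hclosed : IsClosed S := by
    have : S = Set.Ici 0 ∩ ⋂ N, {z | z * ∑ n ∈ Finset.range N, r n * z ^ n ≤ c} := by
      ext z; simp [S]
    rw [this]
    refine isClosed_Ici.inter (isClosed_iInter fun N => ?_)
    exact isClosed_le (by fun_prop) continuous_const
  have hsub : S ⊆ Set.Icc 0 c := by
    rintro z ⟨hz, h⟩
    refine ⟨hz, ?_⟩
    have := h 1
    simp only [Finset.range_one, Finset.sum_singleton, pow_zero, mul_one] at this
    nlinarith
  have hcomp : IsCompact S := isCompact_Icc.of_isClosed_subset hclosed hsub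
  obtain ⟨z, ⟨hz0, hzN⟩, hmax⟩ := hcomp.exists_isGreatest ⟨0, le_rfl, fun N => by simp [hc.le]⟩
  have hnn : ∀ {x : ℝ}, 0 ≤ x → ∀ n, 0 ≤ r n * x ^ n := fun hx n =>
    mul_nonneg (h0 n) (pow_nonneg hx n)
  have hsum : Summable fun n => r n * z ^ n := by
    rcases hz0.eq_or_lt with rfl | hz
    · refine summable_of_ne_finset_zero (s := {0}) fun n hn => ?_
      have : n ≠ 0 := by simpa using hn
      simp [this]
    · exact summable_of_sum_range_le (c := c / z) (hnn hz0) fun N => by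
        rw [le_div_iff₀' hz]; exact hzN N
  have hle : z * ∑' n, r n * z ^ n ≤ c :=
    le_of_tendsto (hsum.hasSum.tendsto_sum_nat.const_mul z) (Eventually.of_forall hzN)
  have heq : z * ∑' n, r n * z ^ n = c := by
    -- If the value at the maximum were below `c`, continuity up to `z₁` would give a larger element
    -- of `S`.
    by_contra hne
    have hlt := lt_of_le_of_ne hle hne
    obtain ⟨z₁, hz1, hs1⟩ := hopen z hz0 hsum
    have hcont : ContinuousOn (fun x => x * ∑' n, r n * x ^ n) (Set.Icc 0 z₁) := by
      refine continuousOn_id.mul (continuousOn_tsum (fun n => by fun_prop) hs1 ?_)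
      intro n x hx
      rw [Real.norm_of_nonneg (hnn hx.1 n)]
      exact mul_le_mul_of_nonneg_left (pow_le_pow_left₀ hx.1 hx.2 n) (h0 n)
    have hev : ∀ᶠ x in 𝓝[>] z, x * ∑' n, r n * x ^ n < c := by
      have h1 : Tendsto (fun x => x * ∑' n, r n * x ^ n) (𝓝[Set.Icc 0 z₁] z)
        (𝓝 (z * ∑' n, r n * z ^ n)) := hcont z ⟨hz0, hz1.le⟩
      have h2 : 𝓝[>] z ≤ 𝓝[Set.Icc 0 z₁] z := by
        rw [← nhdsWithin_Ioc_eq_nhdsGT hz1]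
        exact nhdsWithin_mono _ fun x hx => ⟨hz0.trans hx.1.le, hx.2⟩
      exact (h1.mono_left h2).eventually_lt_const hlt
    obtain ⟨x, hx, hxz, hxz1⟩ := (hev.and (Ioc_mem_nhdsGT hz1)).exists
    have hx0 : 0 ≤ x := hz0.trans hxz.le
    have hsx : Summable fun n => r n * x ^ n := hs1.of_nonneg_of_le (hnn hx0) fun n =>
      mul_le_mul_of_nonneg_left (pow_le_pow_left₀ hx0 hxz1 n) (h0 n)
    have : x ∈ S := ⟨hx0, fun N => le_trans
      (mul_le_mul_of_nonneg_left (hsx.sum_le_tsum _ fun n _ => hnn hx0 n) hx0) hx.le⟩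
    exact absurd (hmax this) (not_le.2 hxz)
  refine ⟨z, hz0.lt_of_ne ?_, hsum, heq⟩
  rintro rfl
  simp at heq
  exact hc.ne heq

/-! ### Generating functions of formal languages -/

section GenFun

variable {A : Type*}

/-- The generating function of a formal language, with values in `[0, ∞]`. -/
noncomputable def genFun (L : Set (List A)) (z : ℝ≥0∞) : ℝ≥0∞ := ∑' w : L, z ^ w.1.length

theorem finite_words [Finite A] (L : Set (List A)) (n : ℕ) :
    {w : List A | w ∈ L ∧ w.length = n}.Finite :=
  (List.finite_length_eq A n).subset fun _ h => h.2

theorem genFun_eq_tsum [Finite A] (L : Set (List A)) (z : ℝ≥0∞) :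
    genFun L z = ∑' n, (wordCount L n : ℝ≥0∞) * z ^ n := by
  rw [genFun, ← (Equiv.sigmaFiberEquiv fun w : L => w.1.length).tsum_eq, ENNReal.tsum_sigma']
  refine tsum_congr fun n => ?_
  have h : ∀ w : {w : L // w.1.length = n},
      z ^ ((Equiv.sigmaFiberEquiv fun w : L => w.1.length) ⟨n, w⟩).1.length = z ^ n := by
    intro w
    simp [Equiv.sigmaFiberEquiv, w.2]
  simp only [h, ENNReal.tsum_const]
  congr 1
  have e : {w : L // w.1.length = n} ≃ {w : List A | w ∈ L ∧ w.length = n} :=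
    Equiv.subtypeSubtypeEquivSubtypeInter (· ∈ L) fun w => w.length = n
  rw [ENat.card_congr e]
  change ((Set.encard _ : ℕ∞) : ℝ≥0∞) = _
  rw [← (finite_words L n).cast_ncard_eq]
  simp [wordCount]

theorem genFun_ofReal [Finite A] (L : Set (List A)) {z : ℝ} (hz : 0 ≤ z) :
    genFun L (ENNReal.ofReal z) = ∑' n, ENNReal.ofReal (wordCount L n * z ^ n) := by
  rw [genFun_eq_tsum]
  refine tsum_congr fun n => ?_
  rw [ENNReal.ofReal_mul (Nat.cast_nonneg _), ENNReal.ofReal_pow hz, ENNReal.ofReal_natCast]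

theorem genFun_ofReal_ne_top_iff [Finite A] (L : Set (List A)) {z : ℝ} (hz : 0 ≤ z) :
    genFun L (ENNReal.ofReal z) ≠ ∞ ↔ Summable fun n => (wordCount L n : ℝ) * z ^ n := by
  have h0 : ∀ n, 0 ≤ (wordCount L n : ℝ) * z ^ n := fun n => by positivity
  rw [genFun_ofReal L hz]
  refine ⟨fun h => ?_, fun h => ?_⟩
  · exact (ENNReal.summable_toReal h).congr fun n => ENNReal.toReal_ofReal (h0 n)
  · rw [← ENNReal.ofReal_tsum_of_nonneg h0 h]
    exact ENNReal.ofReal_ne_top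

theorem HasGenValue.genFun_eq [Finite A] {L : Set (List A)} {z s : ℝ} (hz : 0 ≤ z)
    (h : HasGenValue L z s) : genFun L (ENNReal.ofReal z) = ENNReal.ofReal s := by
  have h0 : ∀ n, 0 ≤ (wordCount L n : ℝ) * z ^ n := fun n => by positivity
  rw [genFun_ofReal L hz, ← ENNReal.ofReal_tsum_of_nonneg h0 h.summable, h.tsum_eq]

theorem wordCount_mono [Finite A] {L L' : Set (List A)} (h : L ⊆ L') (n : ℕ) :
    wordCount L n ≤ wordCount L' n :=
  Set.ncard_le_ncard (fun _ hw => ⟨h hw.1, hw.2⟩) (finite_words L' n)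

theorem wordCount_add_le [Finite A] {L : Set (List A)}
    (hL : ∀ w w', w ++ w' ∈ L → w ∈ L ∧ w' ∈ L) (m n : ℕ) :
    wordCount L (m + n) ≤ wordCount L m * wordCount L n := by
  rw [wordCount, wordCount, wordCount, ← Set.ncard_prod]
  refine Set.ncard_le_ncard_of_injOn (fun w => (w.take m, w.drop m)) ?_ ?_
    ((finite_words L m).prod (finite_words L n))
  · rintro w ⟨hw, hlen⟩
    have := hL (w.take m) (w.drop m) (by rwa [List.take_append_drop])
    exact ⟨⟨this.1, by simp [hlen]⟩, this.2, by simp [hlen]⟩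
  · rintro w - w' - h
    simp only [Prod.mk.injEq] at h
    rw [← List.take_append_drop m w, h.1, h.2, List.take_append_drop]

/-- If each word of a language can be recovered from an object of bounded length excess and
finitely many choices, the generating function converges where the one of the objects does. -/
theorem genFun_ne_top_of_decode {L : Set (List A)} {I X : Type*} [Finite I] (z : ℝ≥0∞) (hz : z ≠ 0)
    (hz' : z ≠ ∞) (size : X → ℕ) (ℓ : I → ℕ) (dec : I → X → List A)
    (hdec : ∀ w ∈ L, ∃ i x, dec i x = w ∧ size x = w.length + ℓ i)
    (hX : ∑' x, z ^ size x ≠ ∞) : genFun L z ≠ ∞ := by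
  choose i x h using fun w : L => hdec w.1 w.2
  have hinj : Function.Injective fun w : L => (i w, x w) := by
    intro w w' he
    simp only [Prod.mk.injEq] at he
    rw [Subtype.ext_iff, ← (h w).1, ← (h w').1, he.1, he.2]
  have hle : genFun L z ≤ ∑' y : I × X, (z ^ ℓ y.1)⁻¹ * z ^ size y.2 := by
    refine le_trans (le_of_eq ?_) (ENNReal.tsum_comp_le_tsum_of_injective hinj _)
    refine tsum_congr fun w => ?_
    have hp : z ^ ℓ (i w) ≠ 0 := pow_ne_zero _ hz
    rw [(h w).2, pow_add, mul_left_comm, ENNReal.inv_mul_cancel hp (ENNReal.pow_ne_top hz'),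
      mul_one]
  refine ne_top_of_le_ne_top ?_ hle
  have := Fintype.ofFinite I
  rw [ENNReal.tsum_prod (f := fun i x => (z ^ ℓ i)⁻¹ * z ^ size x), tsum_fintype]
  refine ENNReal.sum_ne_top.2 fun i _ => ?_
  rw [ENNReal.tsum_mul_left]
  exact ENNReal.mul_ne_top (ENNReal.inv_ne_top.2 (pow_ne_zero _ hz)) hX

end GenFun

/-! ### Paths -/

namespace LabeledGraph

variable {V E S : Type*} (G : LabeledGraph V E S)

theorem isPath_append {u v : V} {p q : List E} :
    G.IsPath u (p ++ q) v ↔ ∃ w, G.IsPath u p w ∧ G.IsPath w q v := by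
  induction p generalizing u with
  | nil => simp [IsPath]
  | cons e p ih => simp [IsPath, ih, and_assoc]

/-- The edge sequences of all paths. -/
def allPaths : Set (List E) := {p | ∃ u v, G.IsPath u p v}

/-- Serves to decode a path that was closed up by connecting paths of known lengths at both ends. -/
theorem drop_take_append {A : Type*} (a w b : List A) :
    ((a ++ w ++ b).drop a.length).take ((a ++ w ++ b).length - (a.length + b.length)) = w := by
  have : (a ++ w ++ b).length - (a.length + b.length) = w.length := by simp; omega
  rw [this]
  simp

/-- Connecting paths of bounded length turn every path into a closed one at `v₀`, so convergence at
`z` passes to the series of all paths. Its coefficients are submultiplicative, and for them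
convergence follows from a single term of positive index below `1`, an open condition in `z`. -/
theorem exists_summable_of_irreducible [Finite V] [Finite E] (hirr : G.Irreducible) (v₀ : V)
    {z : ℝ} (hz : 0 ≤ z) (hs : Summable fun n => (wordCount (G.closedPaths v₀) n : ℝ) * z ^ n) :
    ∃ z₁, z < z₁ ∧ Summable fun n => (wordCount (G.closedPaths v₀) n : ℝ) * z₁ ^ n := by
  have hsplit : ∀ p q, p ++ q ∈ G.allPaths → p ∈ G.allPaths ∧ q ∈ G.allPaths := by
    rintro p q ⟨u, v, h⟩
    obtain ⟨w, h1, h2⟩ := G.isPath_append.1 h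
    exact ⟨⟨u, w, h1⟩, w, v, h2⟩
  have hN : ∃ N, 0 < N ∧ (wordCount G.allPaths N : ℝ) * z ^ N < 1 := by
    rcases hz.eq_or_lt with rfl | hz0
    · exact ⟨1, one_pos, by simp⟩
    choose q hq using hirr
    have htop : genFun G.allPaths (ENNReal.ofReal z) ≠ ∞ := by
      refine genFun_ne_top_of_decode (I := V × V) (X := G.closedPaths v₀) _
        (by simpa using hz0) ENNReal.ofReal_ne_top (fun p => p.1.length)
        (fun i => (q v₀ i.1).length + (q i.2 v₀).length)
        (fun i p => (p.1.drop (q v₀ i.1).length).take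
          (p.1.length - ((q v₀ i.1).length + (q i.2 v₀).length))) ?_
        ((genFun_ofReal_ne_top_iff _ hz).2 hs)
      rintro p ⟨u, v, hp⟩
      refine ⟨(u, v), (⟨q v₀ u ++ p ++ q v v₀, ?_⟩ : G.closedPaths v₀), drop_take_append _ _ _, ?_⟩
      · exact G.isPath_append.2 ⟨v, G.isPath_append.2 ⟨u, hq _ _, hp⟩, hq _ _⟩
      · simp; ring
    have ht := ((genFun_ofReal_ne_top_iff _ hz).1 htop).tendsto_atTop_zero
    obtain ⟨N, h1, h2⟩ := ((ht.eventually_lt_const one_pos).and (eventually_gt_atTop 0)).exists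
    exact ⟨N, h2, h1⟩
  obtain ⟨N, hN0, hN1⟩ := hN
  have hcont : Continuous fun x : ℝ => (wordCount G.allPaths N : ℝ) * x ^ N := by fun_prop
  obtain ⟨z₁, h1, h2⟩ := (((hcont.tendsto z).mono_left nhdsWithin_le_nhds).eventually_lt_const
    hN1 |>.and self_mem_nhdsWithin : ∀ᶠ x in 𝓝[>] z, _ ∧ x ∈ Set.Ioi z).exists
  have hz1 : 0 ≤ z₁ := hz.trans (le_of_lt h2)
  refine ⟨z₁, h2, Summable.of_nonneg_of_le (fun n => by positivity) (fun n => ?_)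
    (summable_of_submultiplicative (u := fun n => (wordCount G.allPaths n : ℝ) * z₁ ^ n)
      (fun n => by positivity) (fun m n => ?_) hN0 h1)⟩
  · have hsub : G.closedPaths v₀ ⊆ G.allPaths := fun p hp => ⟨v₀, v₀, hp⟩
    exact mul_le_mul_of_nonneg_right (Nat.cast_le.2 (wordCount_mono hsub n)) (by positivity)
  · have : (wordCount G.allPaths (m + n) : ℝ) ≤ wordCount G.allPaths m * wordCount G.allPaths n :=
      mod_cast wordCount_add_le hsplit m n
    calc (wordCount G.allPaths (m + n) : ℝ) * z₁ ^ (m + n)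
        ≤ (wordCount G.allPaths m * wordCount G.allPaths n) * z₁ ^ (m + n) := by gcongr
      _ = _ := by ring

theorem exists_hasGenValue_closedPaths [Finite V] [Finite E] (hirr : G.Irreducible) (v₀ : V)
    {c : ℝ} (hc : 0 < c) : ∃ z, 0 < z ∧ ∃ s, HasGenValue (G.closedPaths v₀) z s ∧ z * s = c := by
  have h1 : (1 : ℝ) ≤ wordCount (G.closedPaths v₀) 0 := by
    have : 0 < wordCount (G.closedPaths v₀) 0 :=
      (Set.ncard_pos (finite_words _ _)).2 ⟨[], rfl, rfl⟩
    exact_mod_cast this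
  obtain ⟨z, hz, hs, h⟩ := exists_mul_tsum_eq (fun n => Nat.cast_nonneg _) h1
    (fun z hz hs => G.exists_summable_of_irreducible hirr v₀ hz hs) hc
  exact ⟨z, hz, _, hs.hasSum, h⟩

/-- The empty path gives `1 ≤ s`, so the factor `z` alone makes the product strictly increasing. -/
theorem lt_of_hasGenValue [Finite E] (v₀ : V) {z z' s s' : ℝ} (hz : 0 < z) (hlt : z < z')
    (hs : HasGenValue (G.closedPaths v₀) z s) (hs' : HasGenValue (G.closedPaths v₀) z' s') :
    z * s < z' * s' := by
  have h1 : 1 ≤ s := by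
    have h0 : (1 : ℝ) ≤ (wordCount (G.closedPaths v₀) 0 : ℝ) * z ^ 0 := by
      have : 0 < wordCount (G.closedPaths v₀) 0 :=
        (Set.ncard_pos (finite_words _ _)).2 ⟨[], rfl, rfl⟩
      rw [pow_zero, mul_one]
      exact_mod_cast this
    exact h0.trans (le_hasSum hs 0 fun n _ => by positivity)
  have h2 : s ≤ s' := hasSum_le (fun n => by gcongr) hs hs'
  nlinarith

end LabeledGraph

/-! ### Derivation trees of the balanced paths -/

section Trees

variable {E Γ : Type*}

/-- Derivation trees of the paths with product `1`: a path in `R`, or a derived path, followed by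
an opening loop, a derived path, a matching closing loop, and a path in `R`. -/
inductive BalTree (R : Set (List E)) (Km Kp : Γ → ℕ)
  | leaf (r : R)
  | node (b : BalTree R Km Kp) (γ : Γ) (k : Fin (Km γ)) (b' : BalTree R Km Kp) (k' : Fin (Kp γ))
      (r : R)

variable {R : Set (List E)} {Km Kp : Γ → ℕ}

namespace BalTree

/-- The edge sequence of a derivation tree. -/
def flat : BalTree R Km Kp → List (Attached E Km Kp)
  | leaf r => r.1.map .base
  | node b γ k b' k' r => b.flat ++ .neg γ k :: (b'.flat ++ .pos γ k' :: r.1.map .base)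

/-- The height of a derivation tree. -/
def height : BalTree R Km Kp → ℕ
  | leaf _ => 0
  | node b _ _ b' _ _ => max b.height b'.height + 1

/-- The weight of a derivation tree, set to `0` if the height is not less than `n`. -/
noncomputable def truncWeight (z : ℝ≥0∞) (n : ℕ) (b : BalTree R Km Kp) : ℝ≥0∞ :=
  if b.height < n then z ^ b.flat.length else 0

/-- A derivation tree is a leaf or has the components of a node. -/
def equivSum (R : Set (List E)) (Km Kp : Γ → ℕ) : BalTree R Km Kp ≃
    R ⊕ (Σ γ : Γ, (Fin (Km γ) × Fin (Kp γ)) × BalTree R Km Kp × BalTree R Km Kp × R) where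
  toFun
    | leaf r => .inl r
    | node b γ k b' k' r => .inr ⟨γ, (k, k'), b, b', r⟩
  invFun
    | .inl r => leaf r
    | .inr ⟨γ, (k, k'), b, b', r⟩ => node b γ k b' k' r
  left_inv b := by cases b <;> rfl
  right_inv x := by rcases x with r | ⟨γ, ⟨k, k'⟩, b, b', r⟩ <;> rfl

/-- Two weights `F` and `H` are allowed so that the recursion covers both the full weight (`F = H`)
and the truncated ones (height bound `n + 1` against `n`). -/
theorem tsum_eq_of_node [Fintype Γ] (z : ℝ≥0∞) (F H : BalTree R Km Kp → ℝ≥0∞)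
    (hleaf : ∀ r, F (leaf r) = z ^ r.1.length)
    (hnode : ∀ b γ k b' k' r, F (node b γ k b' k' r) = z ^ 2 * (H b * (H b' * z ^ r.1.length))) :
    ∑' b, F b = (∑' r : R, z ^ r.1.length) +
      (∑ γ, (Km γ : ℝ≥0∞) * (Kp γ : ℝ≥0∞)) * z ^ 2 *
        ((∑' b, H b) * ((∑' b, H b) * ∑' r : R, z ^ r.1.length)) := by
  rw [← (equivSum R Km Kp).symm.tsum_eq F, ENNReal.summable.tsum_sum (by exact ENNReal.summable)]
  congr 1
  · exact tsum_congr fun r => hleaf r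
  · rw [ENNReal.tsum_sigma', tsum_fintype, Finset.sum_mul, Finset.sum_mul]
    refine Finset.sum_congr rfl fun γ _ => ?_
    have h : ∀ p : (Fin (Km γ) × Fin (Kp γ)) × BalTree R Km Kp × BalTree R Km Kp × R,
        F ((equivSum R Km Kp).symm (.inr ⟨γ, p⟩)) =
          z ^ 2 * (H p.2.1 * (H p.2.2.1 * z ^ p.2.2.2.1.length)) := by
      rintro ⟨⟨k, k'⟩, b, b', r⟩
      exact hnode b γ k b' k' r
    simp only [h]
    rw [ENNReal.tsum_prod (f := fun _ (q : BalTree R Km Kp × BalTree R Km Kp × R) =>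
      z ^ 2 * (H q.1 * (H q.2.1 * z ^ q.2.2.1.length)))]
    rw [ENNReal.tsum_const]
    have hc : (ENat.card (Fin (Km γ) × Fin (Kp γ)) : ℝ≥0∞) = Km γ * Kp γ := by
      simp
    rw [hc, ENNReal.tsum_mul_left, ENNReal.tsum_prod (f := fun b (q : BalTree R Km Kp × R) =>
      (H b * (H q.1 * z ^ q.2.1.length)))]
    simp only [ENNReal.tsum_mul_left, ENNReal.tsum_mul_right]
    rw [ENNReal.tsum_prod (f := fun b (q : R) => (H b * z ^ q.1.length))]
    simp only [ENNReal.tsum_mul_left, ENNReal.tsum_mul_right]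
    ring

theorem length_flat_node (b : BalTree R Km Kp) (γ k b' k' r) :
    (node b γ k b' k' r).flat.length = 2 + (b.flat.length + (b'.flat.length + r.1.length)) := by
  simp [flat]; ring

/-- The functional equation of the generating function of the derivation trees. -/
theorem tsum_flat [Fintype Γ] (R : Set (List E)) (Km Kp : Γ → ℕ) (z : ℝ≥0∞) :
    ∑' b : BalTree R Km Kp, z ^ b.flat.length = (∑' r : R, z ^ r.1.length) +
      (∑ γ, (Km γ : ℝ≥0∞) * (Kp γ : ℝ≥0∞)) * z ^ 2 *
        ((∑' b : BalTree R Km Kp, z ^ b.flat.length) *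
          ((∑' b : BalTree R Km Kp, z ^ b.flat.length) * ∑' r : R, z ^ r.1.length)) :=
  tsum_eq_of_node z _ _ (fun r => by simp [flat]) fun b γ k b' k' r => by
    rw [length_flat_node]; simp only [pow_add]

/-- The generating function of the derivation trees is bounded by each supersolution of its
functional equation. -/
theorem tsum_flat_le [Fintype Γ] (z m : ℝ≥0∞)
    (hm : (∑' r : R, z ^ r.1.length) + (∑ γ, (Km γ : ℝ≥0∞) * (Kp γ : ℝ≥0∞)) * z ^ 2 *
      (m * (m * ∑' r : R, z ^ r.1.length)) ≤ m) :
    ∑' b : BalTree R Km Kp, z ^ b.flat.length ≤ m := by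
  -- Truncation by height iterates the functional equation from `0`, and a supersolution bounds
  -- every iterate. Finite sets of trees have bounded height, so this suffices.
  have key : ∀ n, ∑' b : BalTree R Km Kp, truncWeight z n b ≤ m := by
    intro n
    induction n with
    | zero => simp [truncWeight]
    | succ n ih =>
      rw [tsum_eq_of_node z (truncWeight z (n + 1)) (truncWeight z n)
        (fun r => by simp [truncWeight, height, flat])]
      · refine le_trans ?_ hm
        gcongr
      · intro b γ k b' k' r
        simp only [truncWeight, height, Nat.add_lt_add_iff_right, max_lt_iff, length_flat_node]
        by_cases h1 : b.height < n <;> by_cases h2 : b'.height < n <;> simp [h1, h2, pow_add]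
  rw [ENNReal.tsum_eq_iSup_sum]
  refine iSup_le fun s => ?_
  calc ∑ b ∈ s, z ^ b.flat.length = ∑ b ∈ s, truncWeight z (s.sup height + 1) b := by
        refine Finset.sum_congr rfl fun b hb => ?_
        rw [truncWeight, if_pos (Nat.lt_succ_of_le (Finset.le_sup hb))]
    _ ≤ ∑' b, truncWeight z (s.sup height + 1) b := ENNReal.sum_le_tsum s
    _ ≤ m := key _

end BalTree

/-! ### Stacks of unmatched loops -/

/-- The edge sequence of a list of pairs of a derivation tree and a subsequent edge, the last pair
being the head of the list. -/
def stackFlat {X : Type*} (f : X → Attached E Km Kp) :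
    List (BalTree R Km Kp × X) → List (Attached E Km Kp)
  | [] => []
  | x :: l => stackFlat f l ++ (x.1.flat ++ [f x.2])

/-- Lists of length `n` contribute the `n`-th power of the sum. In `[0, ∞]` the formula includes
divergence: truncated subtraction gives `0`, whose inverse is `∞`. -/
theorem tsum_list_prod {X : Type*} (f : X → ℝ≥0∞) :
    ∑' l : List X, (l.map f).prod = (1 - ∑' x, f x)⁻¹ := by
  rw [← ENNReal.tsum_geometric, ← (List.equivSigmaTuple (α := X)).symm.tsum_eq,
    ENNReal.tsum_sigma']
  refine tsum_congr fun n => ?_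
  have h : ∀ u : Fin n → X, ((List.equivSigmaTuple.symm ⟨n, u⟩).map f).prod = ∏ i, f (u i) := by
    intro u
    simp [List.equivSigmaTuple, List.prod_ofFn, List.map_ofFn]
  simp only [h]
  clear h
  induction n with
  | zero => simp [tsum_fintype]
  | succ n ih =>
    rw [← (Fin.consEquiv fun _ => X).tsum_eq]
    simp only [Fin.consEquiv_apply, Fin.prod_univ_succ, Fin.cons_zero, Fin.cons_succ]
    rw [ENNReal.tsum_prod (f := fun x (u : Fin n → X) => f x * ∏ i, f (u i))]
    simp only [ENNReal.tsum_mul_left, ENNReal.tsum_mul_right, ih, pow_succ']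

theorem pow_length_stackFlat {X : Type*} (f : X → Attached E Km Kp) (z : ℝ≥0∞)
    (l : List (BalTree R Km Kp × X)) :
    z ^ (stackFlat f l).length = (l.map fun x => z ^ x.1.flat.length * z).prod := by
  induction l with
  | nil => simp [stackFlat]
  | cons x l ih => simp [stackFlat, pow_add, ih, mul_comm]

theorem tsum_stackFlat {X : Type*} [Finite X] (f : X → Attached E Km Kp) (z : ℝ≥0∞) :
    ∑' l : List (BalTree R Km Kp × X), z ^ (stackFlat f l).length =
      (1 - Nat.card X * z * ∑' b : BalTree R Km Kp, z ^ b.flat.length)⁻¹ := by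
  simp only [pow_length_stackFlat, tsum_list_prod]
  congr 2
  rw [ENNReal.tsum_prod (f := fun (b : BalTree R Km Kp) (_ : X) => z ^ b.flat.length * z)]
  simp only [ENNReal.tsum_const, ENat.card_eq_coe_natCard, ENNReal.tsum_mul_left,
    ENNReal.tsum_mul_right]
  simp; ring

/-- The opening loops. -/
abbrev OpenLoop (Km : Γ → ℕ) := Σ γ : Γ, Fin (Km γ)

/-- An opening loop as an edge. -/
def openEdge (o : OpenLoop Km) : Attached E Km Kp := .neg o.1 o.2

/-- A closing loop as an edge. -/
def closeEdge (c : OpenLoop Kp) : Attached E Km Kp := .pos c.1 c.2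

/-- The list is empty, or its last entry is not an edge of the original graph. -/
def EndsWithLoop (s : List (Attached E Km Kp)) : Prop := ∀ s' e, s ≠ s' ++ [.base e]

/-- The list is empty, or its last entry is an opening loop. -/
def EndsWithOpen (s : List (Attached E Km Kp)) : Prop :=
  EndsWithLoop s ∧ ∀ s' γ k, s ≠ s' ++ [.pos γ k]

/-- Both `r` and `r'` are the maximal final block of base edges. -/
theorem append_base_inj {s s' : List (Attached E Km Kp)} (hs : EndsWithLoop s)
    (hs' : EndsWithLoop s') {r r' : List E}
    (h : s ++ r.map .base = s' ++ r'.map .base) : s = s' ∧ r = r' := by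
  induction r using List.reverseRecOn generalizing r' with
  | nil =>
    rcases List.eq_nil_or_concat r' with rfl | ⟨q, e, rfl⟩
    · simpa using h
    · simp only [List.map_nil, List.append_nil, List.concat_eq_append, List.map_append,
        List.map_cons, ← List.append_assoc] at h
      exact absurd h (hs _ _)
  | append_singleton r e ih =>
    rcases List.eq_nil_or_concat r' with rfl | ⟨q, e', rfl⟩
    · simp only [List.map_nil, List.append_nil, List.map_append,
        List.map_cons, ← List.append_assoc] at h
      exact absurd h.symm (hs' _ _)
    · simp only [List.concat_eq_append, List.map_append, List.map_cons, List.map_nil,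
        ← List.append_assoc] at h
      obtain ⟨h1, h2⟩ := List.append_inj' h rfl
      obtain ⟨h3, h4⟩ := ih h1
      simp_all

theorem endsWithLoop_append_pos (s : List (Attached E Km Kp)) (γ k) :
    EndsWithLoop (s ++ [.pos γ k]) := by
  intro s' e h
  have := (List.append_inj' h rfl).2
  simp at this

theorem endsWithOpen_append_neg (s : List (Attached E Km Kp)) (γ k) :
    EndsWithOpen (s ++ [.neg γ k]) :=
  ⟨fun s' e h => by have := (List.append_inj' h rfl).2; simp at this,
    fun s' e k h => by have := (List.append_inj' h rfl).2; simp at this⟩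

theorem endsWithOpen_nil : EndsWithOpen ([] : List (Attached E Km Kp)) :=
  ⟨fun s' e h => by simp at h, fun s' e k h => by simp at h⟩

/-- Reading from the right, the derivation tree at the end of a path is determined by the path. -/
theorem BalTree.append_flat_inj (b : BalTree R Km Kp) :
    ∀ (b' : BalTree R Km Kp) (s s' : List (Attached E Km Kp)), EndsWithOpen s → EndsWithOpen s' →
      s ++ b.flat = s' ++ b'.flat → s = s' ∧ b = b' := by
  induction b with
  | leaf r =>
    intro b' s s' hs hs' h
    cases b' with
    | leaf r' =>
      obtain ⟨h1, h2⟩ := append_base_inj hs.1 hs'.1 h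
      exact ⟨h1, by rw [Subtype.ext h2]⟩
    -- Before its final base block a node has a closing loop, whereas a leaf is preceded by `s`,
    -- which does not end with one.
    | node b1 γ k b2 k' r' =>
      have h' : s ++ r.1.map .base =
          ((s' ++ b1.flat ++ [.neg γ k] ++ b2.flat) ++ [.pos γ k']) ++ r'.1.map .base := by
        simpa [flat] using h
      exact absurd (append_base_inj hs.1 (endsWithLoop_append_pos _ _ _) h').1 (hs.2 _ _ _)
  | node b1 γ k b2 k' r ih1 ih2 =>
    intro b' s s' hs hs' h
    cases b' with
    | leaf r' =>
      have h' : s' ++ r'.1.map .base =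
          ((s ++ b1.flat ++ [.neg γ k] ++ b2.flat) ++ [.pos γ k']) ++ r.1.map .base := by
        simpa [flat] using h.symm
      exact absurd (append_base_inj hs'.1 (endsWithLoop_append_pos _ _ _) h').1 (hs'.2 _ _ _)
    | node c1 δ l c2 l' r' =>
      have h' : ((s ++ b1.flat ++ [.neg γ k] ++ b2.flat) ++ [.pos γ k']) ++ r.1.map .base =
          ((s' ++ c1.flat ++ [.neg δ l] ++ c2.flat) ++ [.pos δ l']) ++ r'.1.map .base := by
        simpa [flat] using h
      -- Peeling from the right: the base block, the closing loop, the inner tree (its prefix ends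
      -- with an opening loop), the opening loop, the left tree.
      obtain ⟨h1, h2⟩ := append_base_inj (endsWithLoop_append_pos _ _ _)
        (endsWithLoop_append_pos _ _ _) h'
      obtain ⟨h3, h4⟩ := List.append_inj' h1 rfl
      obtain ⟨h5, rfl⟩ := ih2 _ _ _ (endsWithOpen_append_neg _ _ _)
        (endsWithOpen_append_neg _ _ _) h3
      obtain ⟨h6, h7⟩ := List.append_inj' h5 rfl
      obtain ⟨h8, rfl⟩ := ih1 _ _ _ hs hs' h6
      obtain rfl := Subtype.ext h2
      simp only [List.cons.injEq, Attached.pos.injEq, and_true, Attached.neg.injEq] at h4 h7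
      obtain ⟨rfl, h9⟩ := h4
      obtain ⟨-, h10⟩ := h7
      obtain rfl := eq_of_heq h9
      obtain rfl := eq_of_heq h10
      exact ⟨h8, rfl⟩

theorem endsWithOpen_stackFlat (l : List (BalTree R Km Kp × OpenLoop Km)) :
    EndsWithOpen (stackFlat openEdge l) := by
  cases l with
  | nil => exact endsWithOpen_nil
  | cons x l =>
    rw [stackFlat, ← List.append_assoc]
    exact endsWithOpen_append_neg _ _ _

theorem stackFlat_append_flat_injective :
    Function.Injective fun x : List (BalTree R Km Kp × OpenLoop Km) × BalTree R Km Kp =>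
      stackFlat openEdge x.1 ++ x.2.flat := by
  rintro ⟨l, b⟩ ⟨l', b'⟩ h
  obtain ⟨h1, rfl⟩ := b.append_flat_inj b' _ _ (endsWithOpen_stackFlat l)
    (endsWithOpen_stackFlat l') h
  clear h
  congr 1
  induction l generalizing l' with
  | nil =>
    cases l' with
    | nil => rfl
    | cons x l' => simp [stackFlat] at h1
  | cons x l ih =>
    cases l' with
    | nil => simp [stackFlat] at h1
    | cons y l' =>
      obtain ⟨b1, γ, k⟩ := x
      obtain ⟨b2, δ, k'⟩ := y
      simp only [stackFlat, ← List.append_assoc] at h1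
      obtain ⟨h2, h3⟩ := List.append_inj' h1 rfl
      obtain ⟨h4, rfl⟩ := b1.append_flat_inj b2 _ _ (endsWithOpen_stackFlat l)
        (endsWithOpen_stackFlat l') h2
      rw [ih _ h4]
      simp only [openEdge, List.cons.injEq, Attached.neg.injEq, and_true] at h3
      obtain ⟨rfl, h5⟩ := h3
      obtain rfl := eq_of_heq h5
      rfl

end Trees

/-! ### Computations in the Dyck inverse monoid -/

namespace DyckMonoid

variable {Γ : Type*}

theorem neg_mul_pos_self (γ : Γ) : neg γ * pos γ = 1 :=
  PresentedMonoid.mk_eq_mk_of_rel (DyckRel.cancel γ)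

theorem neg_mul_pos_of_ne {γ γ' : Γ} (h : γ ≠ γ') : neg γ * pos γ' = zero Γ :=
  PresentedMonoid.mk_eq_mk_of_rel (DyckRel.vanish γ γ' h)

theorem zero_mul (x : DyckMonoid Γ) : zero Γ * x = zero Γ := by
  induction x using PresentedMonoid.inductionOn with | _ a
  induction a with
  | one => exact mul_one _
  | of x => exact PresentedMonoid.mk_eq_mk_of_rel (DyckRel.zero_mul x)
  | mul x y hx hy => rw [map_mul, ← mul_assoc, hx, hy]

theorem mul_zero (x : DyckMonoid Γ) : x * zero Γ = zero Γ := by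
  induction x using PresentedMonoid.inductionOn with | _ a
  induction a with
  | one => exact one_mul _
  | of x => exact PresentedMonoid.mk_eq_mk_of_rel (DyckRel.mul_zero x)
  | mul x y hx hy => rw [map_mul, mul_assoc, hy, hx]

open Classical in
/-- Removal of `γ` from the top of a stack. -/
noncomputable def pop (γ : Γ) : List Γ → Option (List Γ)
  | [] => none
  | δ :: s => if δ = γ then some s else none

/-- The partial transformation of stacks that is assigned to a generator. -/
noncomputable def genAct : DyckGen Γ → (Function.End (Option (List Γ)))ᵐᵒᵖ
  | .neg γ => .op fun o => o.map (γ :: ·)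
  | .pos γ => .op fun o => o.bind (pop γ)
  | .zero => .op fun _ => none

/-- The action of the Dyck inverse monoid on stacks by partial transformations. -/
noncomputable def act : DyckMonoid Γ →* (Function.End (Option (List Γ)))ᵐᵒᵖ :=
  PresentedMonoid.lift genAct <| by
    rintro _ _ (γ | ⟨γ, γ', h⟩ | a | a)
    · apply MulOpposite.unop_injective
      funext o
      change (o.map (γ :: ·)).bind (pop γ) = o
      cases o <;> simp [pop]
    · apply MulOpposite.unop_injective
      funext o
      change (o.map (γ :: ·)).bind (pop γ') = none
      cases o <;> simp [pop, h]
    · apply MulOpposite.unop_injective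
      funext o
      cases a <;> rfl
    · apply MulOpposite.unop_injective
      funext o
      cases a <;> rfl

/-- The stack that results from an application of `x` to a stack, if there is one. -/
noncomputable def run (x : DyckMonoid Γ) (s : List Γ) : Option (List Γ) := (act x).unop (some s)

theorem run_zero (s : List Γ) : run (zero Γ) s = none := rfl

theorem run_one (s : List Γ) : run 1 s = some s := by rw [run, map_one]; rfl

theorem run_neg (γ : Γ) (s : List Γ) : run (neg γ) s = some (γ :: s) := rfl

theorem run_pos (γ : Γ) (s : List Γ) : run (pos γ) (γ :: s) = some s := by
  change pop γ (γ :: s) = _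
  simp [pop]

/-- Because `act` takes values in the opposite monoid, the left factor acts first, as words are
read. -/
theorem run_mul {x y : DyckMonoid Γ} {s t : List Γ} (h : run x s = some t) :
    run (x * y) s = run y t := by
  have h' : run (x * y) s = (act y).unop (run x s) := by rw [run, map_mul]; rfl
  rw [h', h, run]

/-- The zero element acts as the nowhere defined map, so one stack on which `x` is defined certifies
that `x` is not zero. -/
theorem ne_zero_of_run {x : DyckMonoid Γ} {s t : List Γ} (h : run x s = some t) : x ≠ zero Γ := by
  rintro rfl
  simp [run_zero] at h

/-- The elements that can be applied to each stack. -/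
def IsTotal (x : DyckMonoid Γ) : Prop := ∀ s, ∃ t, run x s = some t

theorem IsTotal.mul {x y : DyckMonoid Γ} (hx : IsTotal x) (hy : IsTotal y) : IsTotal (x * y) := by
  intro s
  obtain ⟨t, ht⟩ := hx s
  rw [run_mul ht]
  exact hy t

theorem isTotal_one : IsTotal (1 : DyckMonoid Γ) := fun s => ⟨s, run_one s⟩

theorem isTotal_neg (γ : Γ) : IsTotal (neg γ) := fun s => ⟨γ :: s, run_neg γ s⟩

theorem IsTotal.pow {x : DyckMonoid Γ} (hx : IsTotal x) (n : ℕ) : IsTotal (x ^ n) := by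
  induction n with
  | zero => rw [pow_zero]; exact isTotal_one
  | succ n ih => rw [pow_succ]; exact ih.mul hx

theorem run_pos_pow (γ : Γ) (n : ℕ) : run (pos γ ^ n) (List.replicate n γ) = some [] := by
  induction n with
  | zero => exact run_one _
  | succ n ih => rw [pow_succ', List.replicate_succ, run_mul (run_pos _ _), ih]

end DyckMonoid

/-! ### Products along paths -/

section Products

variable {E Γ : Type*} {R : Set (List E)} {Km Kp : Γ → ℕ}

theorem prod_phi_base (r : List E) :
    ((r.map (Attached.base (Km := Km) (Kp := Kp))).map phi).prod = 1 := by
  simp [Function.comp_def, phi]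

theorem BalTree.prod_phi_flat (b : BalTree R Km Kp) : (b.flat.map phi).prod = 1 := by
  induction b with
  | leaf r => exact prod_phi_base _
  | node b γ k b' k' r ih1 ih2 =>
    rw [flat, List.map_append, List.prod_append, ih1, List.map_cons, List.prod_cons,
      List.map_append, List.prod_append, ih2, List.map_cons, List.prod_cons, prod_phi_base]
    simp [phi, DyckMonoid.neg_mul_pos_self]

theorem isTotal_prod_phi_stackFlat (l : List (BalTree R Km Kp × OpenLoop Km)) :
    DyckMonoid.IsTotal ((stackFlat openEdge l).map phi).prod := by
  induction l with
  | nil => exact DyckMonoid.isTotal_one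
  | cons x l ih =>
    rw [stackFlat, List.map_append, List.prod_append, List.map_append, List.prod_append,
      x.1.prod_phi_flat, one_mul]
    refine ih.mul ?_
    simpa [openEdge, phi] using DyckMonoid.isTotal_neg _

end Products

/-! ### Paths in the graph with attached loops -/

namespace LabeledGraph

variable {V E S Γ : Type*} (G : LabeledGraph V E S) (v₀ : V) {Km Kp : Γ → ℕ}

theorem prod_phi_label (p : List (Attached E Km Kp)) :
    ((p.map (G.attach v₀ Km Kp).label).map phi).prod = (p.map phi).prod := by
  rw [List.map_map]
  congr 2
  funext e
  cases e <;> rfl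

theorem isPath_map_base {u v : V} {r : List E} :
    (G.attach v₀ Km Kp).IsPath u (r.map .base) v ↔ G.IsPath u r v := by
  induction r generalizing u with
  | nil => rfl
  | cons e r ih => simp only [List.map_cons, IsPath, ih]; rfl

theorem isPath_flat (b : BalTree (G.closedPaths v₀) Km Kp) :
    (G.attach v₀ Km Kp).IsPath v₀ b.flat v₀ := by
  induction b with
  | leaf r => exact (G.isPath_map_base v₀).2 r.2
  | node b γ k b' k' r ih1 ih2 =>
    rw [BalTree.flat, isPath_append]
    refine ⟨v₀, ih1, rfl, ?_⟩
    rw [isPath_append]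
    exact ⟨v₀, ih2, rfl, (G.isPath_map_base v₀).2 r.2⟩

theorem isPath_stackFlat (l : List (BalTree (G.closedPaths v₀) Km Kp × OpenLoop Km)) :
    (G.attach v₀ Km Kp).IsPath v₀ (stackFlat openEdge l) v₀ := by
  induction l with
  | nil => rfl
  | cons x l ih =>
    rw [stackFlat, isPath_append]
    refine ⟨v₀, ih, ?_⟩
    rw [isPath_append]
    exact ⟨v₀, G.isPath_flat v₀ _, rfl, rfl⟩

theorem RightResolving.attach {G : LabeledGraph V E S} (h : G.RightResolving) (v₀ : V)
    (Km Kp : Γ → ℕ) : (G.attach v₀ Km Kp).RightResolving := by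
  intro e e' hs hl
  cases e <;> cases e' <;> simp_all [LabeledGraph.attach]
  exact h _ _ hs hl

theorem RightResolving.eq_of_map_label {G : LabeledGraph V E S} (h : G.RightResolving)
    {u v v' : V} {p p' : List E} (hp : G.IsPath u p v) (hp' : G.IsPath u p' v')
    (hl : p.map G.label = p'.map G.label) : p = p' := by
  induction p generalizing u p' with
  | nil => simpa using hl.symm
  | cons e p ih =>
    cases p' with
    | nil => simp at hl
    | cons e' p' =>
      simp only [List.map_cons, List.cons.injEq] at hl
      obtain rfl := h e e' (hp.1.trans hp'.1.symm) hl.1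
      rw [ih hp.2 hp'.2 hl.2]

/-- The maximal final segment of a path that uses no attached loop. -/
theorem exists_base_suffix {u v : V} {p : List (Attached E Km Kp)}
    (hp : (G.attach v₀ Km Kp).IsPath u p v) :
    (∃ q, p = q.map .base ∧ G.IsPath u q v) ∨
      ∃ p' q a, p = p' ++ a :: q.map .base ∧ (∀ e, a ≠ .base e) ∧
        (G.attach v₀ Km Kp).IsPath u p' v₀ ∧ G.IsPath v₀ q v := by
  induction p generalizing u with
  | nil => exact .inl ⟨[], rfl, hp⟩
  | cons e p ih =>
    rcases ih hp.2 with ⟨q, rfl, hq⟩ | ⟨p', q, a, rfl, ha, hp', hq⟩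
    · cases e with
      | base e => exact .inl ⟨e :: q, rfl, hp.1, hq⟩
      | neg γ k => exact .inr ⟨[], q, .neg γ k, rfl, by simp, hp.1.symm, hq⟩
      | pos γ k => exact .inr ⟨[], q, .pos γ k, rfl, by simp, hp.1.symm, hq⟩
    · exact .inr ⟨e :: p', q, a, rfl, ha, ⟨hp.1, hp'⟩, hq⟩

/-- Each admissible closed path at `v₀` is parsed by derivation trees, separated by the unmatched
loops. -/
theorem exists_parse (p : List (Attached E Km Kp)) (hp : (G.attach v₀ Km Kp).IsPath v₀ p v₀)
    (h0 : (p.map phi).prod ≠ DyckMonoid.zero Γ) :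
    ∃ (c : List (BalTree (G.closedPaths v₀) Km Kp × OpenLoop Kp))
      (o : List (BalTree (G.closedPaths v₀) Km Kp × OpenLoop Km))
      (b : BalTree (G.closedPaths v₀) Km Kp),
      stackFlat closeEdge c ++ (stackFlat openEdge o ++ b.flat) = p := by
  induction hn : p.length using Nat.strong_induction_on generalizing p with
  | _ n ih =>
    -- Induction removes the last attached loop and the base segment after it.
    rcases G.exists_base_suffix v₀ hp with ⟨q, rfl, hq⟩ | ⟨p', q, a, rfl, ha, hp', hq⟩
    · exact ⟨[], [], .leaf ⟨q, hq⟩, rfl⟩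
    have h0' : (p'.map phi).prod ≠ DyckMonoid.zero Γ := fun h => h0 <| by
      rw [List.map_append, List.prod_append, h, DyckMonoid.zero_mul]
    obtain ⟨c, o, b, rfl⟩ := ih p'.length (by simp [← hn]) p' hp' h0' rfl
    cases a with
    | base e => exact absurd rfl (ha e)
    | neg γ k => exact ⟨c, (b, ⟨γ, k⟩) :: o, .leaf ⟨q, hq⟩, by
        simp [stackFlat, openEdge, BalTree.flat]⟩
    | pos γ k =>
      -- With no open loop left, the closing loop is unmatched and everything so far joins `c`.
      -- Otherwise it must match the last open loop, since a mismatch makes the product zero, and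
      -- the two form a node.
      rcases o with _ | ⟨⟨b', δ, l⟩, o⟩
      · exact ⟨(b, ⟨γ, k⟩) :: c, [], .leaf ⟨q, hq⟩, by
          simp [stackFlat, closeEdge, BalTree.flat]⟩
      · obtain rfl : δ = γ := by
          by_contra hne
          apply h0
          simp only [stackFlat, List.map_append, List.prod_append, BalTree.prod_phi_flat,
            List.map_cons, List.prod_cons, List.map_nil, List.prod_nil, openEdge, phi, mul_one,
            one_mul, prod_phi_base, mul_assoc]
          rw [DyckMonoid.neg_mul_pos_of_ne hne, DyckMonoid.mul_zero, DyckMonoid.mul_zero]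
        exact ⟨c, o, .node b' δ l b k ⟨q, hq⟩, by simp [stackFlat, openEdge, BalTree.flat]⟩

end LabeledGraph

/-! ### The language of the subshift -/

section Language

theorem length_blockAt {A : Type*} (x : ℤ → A) (i : ℤ) (n : ℕ) : (blockAt x i n).length = n := by
  simp [blockAt]

theorem blockAt_add {A : Type*} (x : ℤ → A) (i : ℤ) (m n : ℕ) :
    blockAt x i (m + n) = blockAt x i m ++ blockAt x (i + m) n := by
  simp [blockAt, List.ofFn_add, add_assoc]

theorem language_split {A : Type*} [TopologicalSpace A]
    (X : SymbolicDynamics.FullShift.Subshift A ℤ) (w w' : List A) (h : w ++ w' ∈ language X) :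
    w ∈ language X ∧ w' ∈ language X := by
  obtain ⟨x, hx, i, n, h⟩ := h
  obtain rfl : n = w.length + w'.length := by
    rw [← length_blockAt x i n, ← h, List.length_append]
  rw [blockAt_add] at h
  obtain ⟨h1, h2⟩ := List.append_inj h (length_blockAt _ _ _).symm
  exact ⟨⟨x, hx, i, _, h1⟩, x, hx, _, _, h2⟩

theorem language_subshiftOfWords_subset {A : Type*} [TopologicalSpace A] [DiscreteTopology A]
    (L : Set (List A)) : language (subshiftOfWords L) ⊆ L := by
  rintro _ ⟨x, hx, i, n, rfl⟩
  exact hx i n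

/-- A word that can be extended by arbitrarily many letters `a` to the left and `b` to the right
appears in a point. -/
theorem mem_language_of_extend {A : Type*} [TopologicalSpace A] [DiscreteTopology A]
    {L : Set (List A)} (hL : ∀ u w v, u ++ w ++ v ∈ L → w ∈ L) (a b : A) (w : List A)
    (hw : ∀ m n, List.replicate m a ++ w ++ List.replicate n b ∈ L) :
    w ∈ language (subshiftOfWords L) := by
  let x : ℤ → A := fun i => if i < 0 then a else w.getD i.toNat b
  have h1 : ∀ m : ℕ, blockAt x (-m) m = List.replicate m a := by
    intro m
    refine List.ext_getElem (by simp [blockAt]) fun k h h' => ?_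
    have : (-m + k : ℤ) < 0 := by simp [blockAt] at h; omega
    simp only [blockAt, List.getElem_ofFn, x, if_pos this, List.getElem_replicate]
  have h2 : blockAt x 0 w.length = w := by
    refine List.ext_getElem (by simp [blockAt]) fun k h h' => ?_
    simp [blockAt, x]
  have h3 : ∀ n : ℕ, blockAt x w.length n = List.replicate n b := by
    intro n
    refine List.ext_getElem (by simp [blockAt]) fun k h h' => ?_
    have h4 : ¬ (w.length + k : ℤ) < 0 := by omega
    have h5 : (w.length + k : ℤ).toNat = w.length + k := by omega
    simp [blockAt, x, h4, h5]
  refine ⟨x, fun i n => ?_, 0, w.length, h2.symm⟩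
  -- The window at `i` is enlarged to one that starts at `-m` and contains all of `w`.
  obtain ⟨m, hm⟩ : ∃ m : ℕ, -(m : ℤ) ≤ i := ⟨i.natAbs, by omega⟩
  obtain ⟨k, hk⟩ : ∃ k : ℕ, i = -(m : ℤ) + k := ⟨(i + m).toNat, by omega⟩
  have hmem : blockAt x (-m) (m + w.length + (k + n)) ∈ L := by
    rw [blockAt_add, blockAt_add, show -(m : ℤ) + m = 0 by ring,
      show -(m : ℤ) + ((m + w.length : ℕ) : ℤ) = w.length by push_cast; ring, h1, h2, h3]
    exact hw _ _
  rw [show m + w.length + (k + n) = k + n + (m + w.length) by ring, blockAt_add,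
    blockAt_add, ← hk] at hmem
  exact hL _ _ _ hmem

variable {V E S Γ : Type*} (G : LabeledGraph V E S) (v₀ : V) (Km Kp : Γ → ℕ)

theorem admissibleWords_infix (u w v : List (Attached S Km Kp))
    (h : u ++ w ++ v ∈ admissibleWords G v₀ Km Kp) : w ∈ admissibleWords G v₀ Km Kp := by
  obtain ⟨p, s, t, hp, hl, h0⟩ := h
  obtain ⟨p12, p3, rfl, h12, -⟩ := List.map_eq_append_iff.1 hl.symm
  obtain ⟨p1, p2, rfl, -, rfl⟩ := List.map_eq_append_iff.1 h12
  obtain ⟨t', h12', -⟩ := (G.attach v₀ Km Kp).isPath_append.1 hp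
  obtain ⟨s', -, h2'⟩ := (G.attach v₀ Km Kp).isPath_append.1 h12'
  refine ⟨p2, s', t', h2', rfl, fun h => h0 ?_⟩
  rw [List.map_append, List.prod_append, List.map_append, List.prod_append, h,
    DyckMonoid.mul_zero, DyckMonoid.zero_mul]

theorem isPath_replicate {e : Attached E Km Kp} (hs : (G.attach v₀ Km Kp).src e = v₀)
    (ht : (G.attach v₀ Km Kp).tgt e = v₀) (n : ℕ) :
    (G.attach v₀ Km Kp).IsPath v₀ (List.replicate n e) v₀ := by
  induction n with
  | zero => rfl
  | succ n ih => exact ⟨hs, by rwa [ht]⟩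

/-- The label sequence of a closed path at `v₀` without unmatched closing loops appears in a
point. -/
theorem map_label_mem_language {p : List (Attached E Km Kp)}
    (hp : (G.attach v₀ Km Kp).IsPath v₀ p v₀) (h0 : DyckMonoid.IsTotal (p.map phi).prod) (γ : Γ)
    (hm : 0 < Km γ) (hk : 0 < Kp γ) :
    p.map (G.attach v₀ Km Kp).label ∈ language (attachedSubshift G v₀ Km Kp) := by
  -- Closing loops on the left and opening loops on the right can be added without end, as no such
  -- loop is mismatched.
  refine mem_language_of_extend (admissibleWords_infix G v₀ Km Kp) (.pos γ ⟨0, hk⟩)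
    (.neg γ ⟨0, hm⟩) _ fun m n => ?_
  refine ⟨List.replicate m (.pos γ ⟨0, hk⟩) ++ p ++ List.replicate n (.neg γ ⟨0, hm⟩), v₀, v₀,
    ?_, ?_, ?_⟩
  · rw [LabeledGraph.isPath_append]
    refine ⟨v₀, ?_, isPath_replicate G v₀ Km Kp rfl rfl n⟩
    rw [LabeledGraph.isPath_append]
    exact ⟨v₀, isPath_replicate G v₀ Km Kp rfl rfl m, hp⟩
  · simp [LabeledGraph.attach]
  -- A stack of `m` copies of `γ` absorbs the closing loops; the rest is defined on every stack.
  · obtain ⟨t, ht⟩ := (h0.mul ((DyckMonoid.isTotal_neg γ).pow n)) []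
    refine DyckMonoid.ne_zero_of_run (s := List.replicate m γ) (t := t) ?_
    rw [← ht]
    simp only [List.map_append, List.prod_append, List.map_replicate, List.prod_replicate,
      mul_assoc, phi, LabeledGraph.prod_phi_label]
    exact DyckMonoid.run_mul (DyckMonoid.run_pos_pow γ m)

end Language

/-! ### Entropy and the generating function of the language -/

/-- The exponential growth rate of a submultiplicative sequence is determined by the radius of
convergence of its generating function. -/
theorem tendsto_log_div_of_submultiplicative {W : ℕ → ℕ} (h1 : ∀ n, 0 < W n)
    (hmul : ∀ m n, W (m + n) ≤ W m * W n) {z₀ : ℝ} (hz₀ : 0 < z₀)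
    (hdiv : ¬ Summable fun n => (W n : ℝ) * z₀ ^ n)
    (hconv : ∀ z, 0 < z → z < z₀ → Summable fun n => (W n : ℝ) * z ^ n) :
    Tendsto (fun n : ℕ => 1 / (n : ℝ) * Real.log (W n)) atTop (𝓝 (-Real.log z₀)) := by
  have hpos : ∀ n, (0 : ℝ) < W n := fun n => Nat.cast_pos.2 (h1 n)
  have hsub : Subadditive fun n => Real.log (W n) := fun m n => by
    rw [← Real.log_mul (hpos m).ne' (hpos n).ne']
    exact Real.log_le_log (hpos _) (mod_cast hmul m n)
  have hbdd : BddBelow (Set.range fun n : ℕ => Real.log (W n) / n) :=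
    ⟨0, by
      rintro _ ⟨n, rfl⟩
      exact div_nonneg (Real.log_natCast_nonneg _) (Nat.cast_nonneg _)⟩
  have hlim := hsub.tendsto_lim hbdd
  have hexp : ∀ (c : ℝ) (n : ℕ), Real.exp c ^ n = Real.exp (c * n) := fun c n => by
    rw [← Real.exp_nat_mul, mul_comm]
  have heq : hsub.lim = -Real.log z₀ := by
    apply le_antisymm
    -- A growth rate above `c > -log z₀` contradicts that the terms at `exp (-c) < z₀` tend to zero.
    · by_contra! hlt
      obtain ⟨c, hc1, hc2⟩ := exists_between hlt
      have hz : Real.exp (-c) < z₀ := by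
        rw [← Real.lt_log_iff_exp_lt hz₀]; linarith
      have ht := (hconv _ (Real.exp_pos _) hz).tendsto_atTop_zero
      obtain ⟨n, ⟨hn1, hn2⟩, hn3⟩ := (((ht.eventually_lt_const one_pos).and
        (hlim.eventually_const_lt hc2)).and (eventually_gt_atTop 0)).exists
      have hn : (0 : ℝ) < n := Nat.cast_pos.2 hn3
      rw [lt_div_iff₀ hn, Real.lt_log_iff_exp_lt (hpos n)] at hn2
      rw [hexp] at hn1
      have : (1 : ℝ) < 1 := calc
        (1 : ℝ) = Real.exp (c * n) * Real.exp (-c * n) := by rw [← Real.exp_add]; simp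
        _ ≤ W n * Real.exp (-c * n) := by gcongr
        _ < 1 := hn1
      exact lt_irrefl _ this
    -- A growth rate below `c < -log z₀` would make the series at `z₀` geometrically dominated.
    · by_contra! hlt
      obtain ⟨c, hc1, hc2⟩ := exists_between hlt
      apply hdiv
      have hz : Real.exp c * z₀ < 1 := by
        rw [← Real.exp_log hz₀, ← Real.exp_add, Real.exp_lt_one_iff]; linarith
      refine Summable.of_norm_bounded_eventually_nat
        (summable_geometric_of_lt_one (by positivity) hz) ?_
      filter_upwards [hlim.eventually_lt_const hc1, eventually_gt_atTop 0] with n hn1 hn3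
      have hn : (0 : ℝ) < n := Nat.cast_pos.2 hn3
      rw [div_lt_iff₀ hn, Real.log_lt_iff_lt_exp (hpos n)] at hn1
      rw [Real.norm_of_nonneg (by positivity), mul_pow, hexp]
      gcongr
  rw [← heq]
  refine hlim.congr fun n => ?_
  ring

variable {V E S Γ : Type*} (G : LabeledGraph V E S) (v₀ : V) (Km Kp : Γ → ℕ)

/-- The generating function of the closed paths at `v₀` with product `1`. -/
noncomputable def balGenFun (z : ℝ≥0∞) : ℝ≥0∞ :=
  ∑' b : BalTree (G.closedPaths v₀) Km Kp, z ^ b.flat.length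

theorem one_le_balGenFun (z : ℝ≥0∞) : 1 ≤ balGenFun G v₀ Km Kp z := by
  have h := ENNReal.le_tsum (f := fun b : BalTree (G.closedPaths v₀) Km Kp => z ^ b.flat.length)
    (.leaf ⟨[], rfl⟩)
  simpa [balGenFun, BalTree.flat] using h

theorem card_openLoop [Fintype Γ] (K : Γ → ℕ) : Nat.card (OpenLoop K) = ∑ γ, K γ := by
  simp [OpenLoop]

instance [Finite E] [Finite Γ] : Finite (Attached E Km Kp) := by
  refine Finite.of_surjective
    (fun x : E ⊕ (OpenLoop Km ⊕ OpenLoop Kp) => (match x with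
      | .inl e => Attached.base e
      | .inr (.inl o) => openEdge o
      | .inr (.inr c) => closeEdge c : Attached E Km Kp)) ?_
  rintro (e | ⟨γ, k⟩ | ⟨γ, k⟩)
  · exact ⟨.inl e, rfl⟩
  · exact ⟨.inr (.inl ⟨γ, k⟩), rfl⟩
  · exact ⟨.inr (.inr ⟨γ, k⟩), rfl⟩

/-- Connecting paths in the original graph have product `1`, so they keep a path admissible while
closing it up at `v₀`. For an upper bound a parse need only exist; the sum over parses is a product
of two geometric series and the balanced series. -/
theorem genFun_language_ne_top [Finite V] [Fintype Γ] (hirr : G.Irreducible) {z : ℝ≥0∞}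
    (hz : z ≠ 0) (hz' : z ≠ ∞) (htop : balGenFun G v₀ Km Kp z ≠ ∞)
    (hm : (∑ γ, Km γ : ℕ) * z * balGenFun G v₀ Km Kp z < 1)
    (hp : (∑ γ, Kp γ : ℕ) * z * balGenFun G v₀ Km Kp z < 1) :
    genFun (language (attachedSubshift G v₀ Km Kp)) z ≠ ∞ := by
  choose q hq using hirr
  refine genFun_ne_top_of_decode (I := V × V)
    (X := List (BalTree (G.closedPaths v₀) Km Kp × OpenLoop Kp) ×
      List (BalTree (G.closedPaths v₀) Km Kp × OpenLoop Km) × BalTree (G.closedPaths v₀) Km Kp)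
    z hz hz' (fun x => (stackFlat closeEdge x.1).length +
      ((stackFlat openEdge x.2.1).length + x.2.2.flat.length))
    (fun i => (q v₀ i.1).length + (q i.2 v₀).length)
    (fun i x => (((stackFlat closeEdge x.1 ++ (stackFlat openEdge x.2.1 ++ x.2.2.flat)).drop
      (q v₀ i.1).length).take ((stackFlat closeEdge x.1 ++ (stackFlat openEdge x.2.1 ++
        x.2.2.flat)).length - ((q v₀ i.1).length + (q i.2 v₀).length))).map
        (G.attach v₀ Km Kp).label) ?_ ?_
  · intro w hw
    obtain ⟨p, u, v, hp, rfl, h0⟩ := language_subshiftOfWords_subset _ hw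
    rw [G.prod_phi_label] at h0
    have hpath : (G.attach v₀ Km Kp).IsPath v₀
        ((q v₀ u).map .base ++ p ++ (q v v₀).map .base) v₀ := by
      rw [LabeledGraph.isPath_append]
      refine ⟨v, ?_, (G.isPath_map_base v₀).2 (hq _ _)⟩
      rw [LabeledGraph.isPath_append]
      exact ⟨u, (G.isPath_map_base v₀).2 (hq _ _), hp⟩
    obtain ⟨c, o, b, h⟩ := G.exists_parse v₀ _ hpath (by
      rwa [List.map_append, List.prod_append, List.map_append, List.prod_append, prod_phi_base,
        prod_phi_base, one_mul, mul_one])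
    refine ⟨(u, v), (c, o, b), ?_, ?_⟩
    · dsimp only
      rw [h]
      have := LabeledGraph.drop_take_append ((q v₀ u).map (Attached.base (Km := Km) (Kp := Kp))) p
        ((q v v₀).map .base)
      rw [List.length_map, List.length_map] at this
      rw [this]
    · dsimp only
      rw [← List.length_append, ← List.length_append, h]
      simp only [List.length_append, List.length_map]
      ring
  · simp only [pow_add]
    rw [ENNReal.tsum_prod (f := fun c (x : List (BalTree (G.closedPaths v₀) Km Kp × OpenLoop Km) ×
      BalTree (G.closedPaths v₀) Km Kp) => z ^ (stackFlat closeEdge c).length *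
        (z ^ (stackFlat openEdge x.1).length * z ^ x.2.flat.length))]
    simp only [ENNReal.tsum_mul_left, ENNReal.tsum_mul_right]
    rw [ENNReal.tsum_prod (f := fun o (b : BalTree (G.closedPaths v₀) Km Kp) =>
      z ^ (stackFlat openEdge o).length * z ^ b.flat.length)]
    simp only [ENNReal.tsum_mul_left, ENNReal.tsum_mul_right]
    rw [tsum_stackFlat, tsum_stackFlat, card_openLoop, card_openLoop]
    refine ENNReal.mul_ne_top ?_ (ENNReal.mul_ne_top ?_ htop) <;>
      exact ENNReal.inv_ne_top.2 (tsub_pos_of_lt (by assumption)).ne'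

/-- Words of paths without unmatched closing loops already force divergence: unambiguity of the
parse and right resolvingness make them distinct, and they sum to a geometric series of ratio at
least `1`. -/
theorem genFun_language_eq_top [Fintype Γ] (hres : G.RightResolving) (γ : Γ) (hKm : 0 < Km γ)
    (hKp : 0 < Kp γ) {z : ℝ≥0∞} (hm : 1 ≤ (∑ γ, Km γ : ℕ) * z * balGenFun G v₀ Km Kp z) :
    genFun (language (attachedSubshift G v₀ Km Kp)) z = ∞ := by
  have hpath : ∀ x : List (BalTree (G.closedPaths v₀) Km Kp × OpenLoop Km) ×
      BalTree (G.closedPaths v₀) Km Kp,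
      (G.attach v₀ Km Kp).IsPath v₀ (stackFlat openEdge x.1 ++ x.2.flat) v₀ := fun x =>
    (G.attach v₀ Km Kp).isPath_append.2 ⟨v₀, G.isPath_stackFlat v₀ _, G.isPath_flat v₀ _⟩
  let word : List (BalTree (G.closedPaths v₀) Km Kp × OpenLoop Km) ×
      BalTree (G.closedPaths v₀) Km Kp → language (attachedSubshift G v₀ Km Kp) := fun x =>
    ⟨(stackFlat openEdge x.1 ++ x.2.flat).map (G.attach v₀ Km Kp).label,
      map_label_mem_language G v₀ Km Kp (hpath x) (by
        rw [List.map_append, List.prod_append, x.2.prod_phi_flat, mul_one]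
        exact isTotal_prod_phi_stackFlat _) γ hKm hKp⟩
  have hinj : Function.Injective word := fun x y h =>
    stackFlat_append_flat_injective ((hres.attach v₀ Km Kp).eq_of_map_label (hpath x) (hpath y)
      (congrArg Subtype.val h))
  have hle := ENNReal.tsum_comp_le_tsum_of_injective hinj fun w => z ^ w.1.length
  refine top_le_iff.1 (le_trans (le_of_eq ?_) hle)
  simp only [word, List.length_map, List.length_append, pow_add]
  rw [ENNReal.tsum_prod (f := fun o (b : BalTree (G.closedPaths v₀) Km Kp) =>
    z ^ (stackFlat openEdge o).length * z ^ b.flat.length)]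
  simp only [ENNReal.tsum_mul_left, ENNReal.tsum_mul_right]
  rw [tsum_stackFlat, card_openLoop]
  have h0 : (1 : ℝ≥0∞) - (∑ γ, Km γ : ℕ) * z * balGenFun G v₀ Km Kp z = 0 :=
    tsub_eq_zero_of_le hm
  change _ = (1 - (∑ γ, Km γ : ℕ) * z * balGenFun G v₀ Km Kp z)⁻¹ * balGenFun G v₀ Km Kp z
  rw [h0, ENNReal.inv_zero, ENNReal.top_mul]
  exact (one_pos.trans_le (one_le_balGenFun G v₀ Km Kp z)).ne'

theorem sum_natCast_mul_eq_ofReal [Fintype Γ] : ∑ γ, (Km γ : ℝ≥0∞) * (Kp γ : ℝ≥0∞) =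
    ENNReal.ofReal (∑ γ, (Km γ : ℝ) * (Kp γ : ℝ)) := by
  rw [ENNReal.ofReal_sum_of_nonneg fun γ _ => by positivity]
  refine Finset.sum_congr rfl fun γ _ => ?_
  rw [ENNReal.ofReal_mul (Nat.cast_nonneg _), ENNReal.ofReal_natCast, ENNReal.ofReal_natCast]

/-- Up to the critical value `z₀` of the variable, the generating function of the closed paths
with product `1` is at most `1 / (K₋ z₀)`. -/
theorem balGenFun_le [Finite E] [Fintype Γ] {z z₀ s k K : ℝ} (hzz : z ≤ z₀)
    (hz₀ : 0 < z₀) (hs : HasGenValue (G.closedPaths v₀) z₀ s) (hk : 0 < k)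
    (hK0 : 0 < K) (hK : K = ∑ γ, (Km γ : ℝ) * (Kp γ : ℝ)) (h : z₀ * s = k / (k ^ 2 + K)) :
    balGenFun G v₀ Km Kp (ENNReal.ofReal z) ≤ ENNReal.ofReal (1 / (k * z₀)) := by
  have hs0 : 0 < s := by
    have : 0 < z₀ * s := by rw [h]; positivity
    exact (pos_iff_pos_of_mul_pos this).1 hz₀
  have hK' := hK ▸ sum_natCast_mul_eq_ofReal Km Kp
  -- The constant `1 / (k z₀)` solves the functional equation at `z₀`, by `h`; the coefficients grow
  -- with `z`, so it is a supersolution at `z`.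
  refine BalTree.tsum_flat_le _ _ ?_
  have hg : ∑' r : G.closedPaths v₀, ENNReal.ofReal z ^ r.1.length ≤ ENNReal.ofReal s := by
    rw [← hs.genFun_eq hz₀.le]
    exact ENNReal.tsum_le_tsum fun r => pow_le_pow_left' (ENNReal.ofReal_le_ofReal hzz) _
  rw [hK']
  calc _ ≤ ENNReal.ofReal s + ENNReal.ofReal K * ENNReal.ofReal z₀ ^ 2 *
        (ENNReal.ofReal (1 / (k * z₀)) * (ENNReal.ofReal (1 / (k * z₀)) * ENNReal.ofReal s)) := by
        gcongr
    _ = ENNReal.ofReal (s + K * z₀ ^ 2 * (1 / (k * z₀) * (1 / (k * z₀) * s))) := by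
        rw [ENNReal.ofReal_add (by positivity) (by positivity), ENNReal.ofReal_mul (by positivity),
          ENNReal.ofReal_mul (by positivity), ENNReal.ofReal_mul (by positivity),
          ENNReal.ofReal_mul (by positivity), ENNReal.ofReal_pow (by positivity)]
    _ ≤ _ := by
        refine ENNReal.ofReal_le_ofReal (le_of_eq ?_)
        have h' : s = k / (k ^ 2 + K) / z₀ := by rw [← h]; field_simp
        rw [h']
        field_simp

/-- At the critical value the bound is attained. -/
theorem one_le_mul_balGenFun [Finite E] [Fintype Γ] {z₀ s k K : ℝ}
    (hz₀ : 0 < z₀) (hs : HasGenValue (G.closedPaths v₀) z₀ s) (hk : 0 < k)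
    (hK0 : 0 < K) (hK : K = ∑ γ, (Km γ : ℝ) * (Kp γ : ℝ)) (hKk : K ≤ k ^ 2)
    (h : z₀ * s = k / (k ^ 2 + K)) :
    1 ≤ ENNReal.ofReal k * ENNReal.ofReal z₀ * balGenFun G v₀ Km Kp (ENNReal.ofReal z₀) := by
  have hle := balGenFun_le G v₀ Km Kp le_rfl hz₀ hs hk hK0 hK h
  have hs0 : 0 < s := by
    have : 0 < z₀ * s := by rw [h]; positivity
    exact (pos_iff_pos_of_mul_pos this).1 hz₀
  have hK' := hK ▸ sum_natCast_mul_eq_ofReal Km Kp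
  have heq := BalTree.tsum_flat (G.closedPaths v₀) Km Kp (ENNReal.ofReal z₀)
  have hg := hs.genFun_eq hz₀.le
  rw [genFun] at hg
  rw [hg, hK'] at heq
  change balGenFun G v₀ Km Kp _ = _ + _ * (balGenFun G v₀ Km Kp _ *
    (balGenFun G v₀ Km Kp _ * _)) at heq
  lift balGenFun G v₀ Km Kp (ENNReal.ofReal z₀) to NNReal
    using ne_top_of_le_ne_top ENNReal.ofReal_ne_top hle with M hM
  have hM0 : (0 : ℝ) ≤ M := M.2
  rw [show (M : ℝ≥0∞) = ENNReal.ofReal M by simp] at heq hle ⊢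
  generalize (M : ℝ) = μ at *
  rw [← ENNReal.ofReal_pow hz₀.le, ← ENNReal.ofReal_mul hK0.le, ← ENNReal.ofReal_mul hM0,
    ← ENNReal.ofReal_mul hM0, ← ENNReal.ofReal_mul (by positivity),
    ← ENNReal.ofReal_add hs0.le (by positivity),
    ENNReal.ofReal_eq_ofReal_iff hM0 (by positivity)] at heq
  rw [ENNReal.ofReal_le_ofReal_iff (by positivity), le_div_iff₀ (by positivity)] at hle
  rw [← ENNReal.ofReal_mul hk.le, ← ENNReal.ofReal_mul (by positivity), ENNReal.one_le_ofReal]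
  by_contra! hlt
  -- In terms of `t` the functional equation has the roots `1` and `k² / K`, and `K ≤ k²` excludes
  -- any root below `1`.
  set t := k * z₀ * μ with ht
  rw [eq_div_iff (by positivity)] at h
  have hquad : (t - 1) * (K * t - k ^ 2) = 0 := by
    have e1 : t * (k ^ 2 + K) = k ^ 2 + K * t ^ 2 := by
      calc t * (k ^ 2 + K)
          = k * z₀ * (s + K * z₀ ^ 2 * (μ * (μ * s))) * (k ^ 2 + K) := by rw [← heq]
        _ = k * (z₀ * s * (k ^ 2 + K)) + K * z₀ ^ 2 * k * μ ^ 2 * (z₀ * s * (k ^ 2 + K)) := by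
            ring
        _ = k ^ 2 + K * t ^ 2 := by rw [h]; ring
    linear_combination -e1
  rcases mul_eq_zero.1 hquad with h1 | h1
  · linarith
  · nlinarith

end DyckSofic

/-! ### The critical value and the entropy -/

theorem corollary2p4 {Γ V E S : Type*} [Fintype Γ] [Finite V] [Finite E] [Finite S]
    (hΓ : 1 < Fintype.card Γ)
    (G : DyckSofic.LabeledGraph V E S) (hirr : G.Irreducible) (hres : G.RightResolving) (v₀ : V)
    (Km Kp : Γ → ℕ) (hKm : ∀ γ, 0 < Km γ) (hKp : ∀ γ, 0 < Kp γ)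
    (hle : ∑ γ, Kp γ ≤ ∑ γ, Km γ) :
    ∃ z : ℝ,
      IsLeast {z : ℝ | 0 < z ∧ ∃ s : ℝ, DyckSofic.HasGenValue (G.closedPaths v₀) z s ∧
        z * s = (∑ γ, (Km γ : ℝ)) / ((∑ γ, (Km γ : ℝ)) ^ 2 + ∑ γ, (Km γ : ℝ) * (Kp γ : ℝ))} z ∧
      DyckSofic.HasTopologicalEntropy (DyckSofic.attachedSubshift G v₀ Km Kp) (-Real.log z) := by
  obtain ⟨γ₀⟩ : Nonempty Γ := Fintype.card_pos_iff.1 (by omega)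
  set k : ℝ := ∑ γ, (Km γ : ℝ) with hkdef
  set K : ℝ := ∑ γ, (Km γ : ℝ) * (Kp γ : ℝ) with hKdef
  have hk : 0 < k := Finset.sum_pos (fun γ _ => Nat.cast_pos.2 (hKm γ)) ⟨γ₀, Finset.mem_univ _⟩
  have hK0 : 0 < K := Finset.sum_pos
    (fun γ _ => mul_pos (Nat.cast_pos.2 (hKm γ)) (Nat.cast_pos.2 (hKp γ))) ⟨γ₀, Finset.mem_univ _⟩
  have hkn : ((∑ γ, Km γ : ℕ) : ℝ) = k := by push_cast; rfl
  have hle' : ∑ γ, (Kp γ : ℝ) ≤ k := by rw [← hkn]; exact_mod_cast hle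
  -- Each `Kp γ` is at most `K₊ ≤ K₋`.
  have hKk : K ≤ k ^ 2 := by
    calc K ≤ ∑ γ, (Km γ : ℝ) * k := by
          refine Finset.sum_le_sum fun γ _ => mul_le_mul_of_nonneg_left ?_ (Nat.cast_nonneg _)
          exact (Finset.single_le_sum (f := fun γ => (Kp γ : ℝ)) (fun γ _ => Nat.cast_nonneg _)
            (Finset.mem_univ γ)).trans hle'
      _ = k ^ 2 := by rw [← Finset.sum_mul, sq]
  have hkE : ((∑ γ, Km γ : ℕ) : ENNReal) = ENNReal.ofReal k := by
    rw [← hkn, ENNReal.ofReal_natCast]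
  obtain ⟨z₀, hz₀, s, hs, h⟩ := G.exists_hasGenValue_closedPaths hirr v₀
    (c := k / (k ^ 2 + K)) (by positivity)
  refine ⟨z₀, ⟨⟨hz₀, s, hs, h⟩, ?_⟩, ?_⟩
  · rintro z ⟨hz, s', hs', h'⟩
    by_contra! hlt
    exact absurd (h'.trans h.symm) (G.lt_of_hasGenValue v₀ hz hlt hs' hs).ne
  have hdiv : ¬ Summable fun n => (DyckSofic.wordCount (DyckSofic.language
      (DyckSofic.attachedSubshift G v₀ Km Kp)) n : ℝ) * z₀ ^ n := by
    rw [← DyckSofic.genFun_ofReal_ne_top_iff _ hz₀.le, not_not]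
    refine DyckSofic.genFun_language_eq_top G v₀ Km Kp hres γ₀ (hKm _) (hKp _) ?_
    rw [hkE]
    exact DyckSofic.one_le_mul_balGenFun G v₀ Km Kp hz₀ hs hk hK0 rfl hKk h
  refine DyckSofic.tendsto_log_div_of_submultiplicative (fun n => ?_)
    (DyckSofic.wordCount_add_le (DyckSofic.language_split _)) hz₀ hdiv fun z hz hlt => ?_
  -- Repeating one opening loop gives a word of every length.
  · have hmem := DyckSofic.map_label_mem_language G v₀ Km Kp
      (DyckSofic.isPath_replicate G v₀ Km Kp (e := .neg γ₀ ⟨0, hKm γ₀⟩) rfl rfl n)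
      (by simpa [DyckSofic.phi] using (DyckSofic.DyckMonoid.isTotal_neg γ₀).pow n) γ₀
      (hKm _) (hKp _)
    exact (Set.ncard_pos (DyckSofic.finite_words _ _)).2 ⟨_, hmem, by simp⟩
  · rw [← DyckSofic.genFun_ofReal_ne_top_iff _ hz.le]
    have hb := DyckSofic.balGenFun_le G v₀ Km Kp hlt.le hz₀ hs hk hK0 rfl h
    have hm : ((∑ γ, Km γ : ℕ) : ENNReal) * ENNReal.ofReal z *
        DyckSofic.balGenFun G v₀ Km Kp (ENNReal.ofReal z) < 1 := by
      rw [hkE]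
      calc _ ≤ ENNReal.ofReal k * ENNReal.ofReal z * ENNReal.ofReal (1 / (k * z₀)) := by gcongr
        _ = ENNReal.ofReal (z / z₀) := by
          rw [← ENNReal.ofReal_mul hk.le, ← ENNReal.ofReal_mul (by positivity)]
          congr 1
          field_simp
        _ < 1 := by
          rw [ENNReal.ofReal_lt_one]
          exact (div_lt_one hz₀).2 hlt
    refine DyckSofic.genFun_language_ne_top G v₀ Km Kp hirr (by simpa using hz)
      ENNReal.ofReal_ne_top (ne_top_of_le_ne_top ENNReal.ofReal_ne_top hb) hm
      -- The series of unmatched closing loops is dominated by that of the opening ones, by `K₊ ≤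
      -- K₋`.
      (lt_of_le_of_lt ?_ hm)
    gcongr
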